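/- Let $X$ be a finite-dimensional real vector space with $\dim X>2$, and let $\|\cdot\|_1$ and $\|\cdot\|_2$ be two norms on $X$. For $i=1,2$, let $B_i=\{x\in X:\|x\|_i\le 1\}$ be the unit ball of $\|\cdot\|_i$, and for nonzero $x,y\in X$ write $x\dashv_i y$ ($x$ is normal to $y$) if $\|x\|_i\le\|x+\lambda y\|_i$ for every real $\lambda$; the relation $\dashv_i$ does not hold if $x=0$ or $y=0$. Then the equivalence $x\dashv_1 y\Leftrightarrow y\dashv_2 x$ holds for all $x,y\in X$ if and only if $B_1$ and $B_2$ are homothetic ellipsoids, that is, both are images of a Euclidean unit ball under affine isomorphisms and $B_2=rB_1+c$ for some real $r>0$ and some $c\in X$. -/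

import Mathlib

/-- Birkhoff normality: a nonzero vector `x` is normal to a nonzero vector `y`, with respect to the
norm `p`, if `p x ≤ p (x + t • y)` for every real `t`. -/
def IsNormalTo {X : Type*} [AddCommGroup X] [Module ℝ X] (p : Seminorm ℝ X) (x y : X) : Prop :=
  x ≠ 0 ∧ y ≠ 0 ∧ ∀ t : ℝ, p x ≤ p (x + t • y)

/-- An ellipsoid (with nonempty interior) in a finite dimensional real vector space: the image of
the closed Euclidean unit ball of the same dimension under an affine isomorphism. -/
def IsEllipsoid {X : Type*} [AddCommGroup X] [Module ℝ X] (E : Set X) : Prop :=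
  ∃ f : EuclideanSpace ℝ (Fin (Module.finrank ℝ X)) ≃ᵃ[ℝ] X,
    E = f '' Metric.closedBall (0 : EuclideanSpace ℝ (Fin (Module.finrank ℝ X))) 1

/-- Two subsets are homothetic if one is a translate of a positive multiple of the other. -/
def AreHomothetic {X : Type*} [AddCommGroup X] [Module ℝ X] (K L : Set X) : Prop :=
  ∃ (r : ℝ) (c : X), 0 < r ∧ L = (fun x : X => r • x + c) '' K

/-!
Assume first that `x` is normal to `y` for `p₁` exactly when `y` is normal to `x` for `p₂`. Given a
plane `P` and a vector outside `P`, subtracting from it a `p₁`-nearest point of `P` produces a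
vector `v` that is `p₁`-normal to `P`, so every element of `P` is `p₂`-normal to `v`. Thus planes
have, for the norm `p₂`, complementary directions along which projections are contractions
(`HasNormalComplements`). This alone forces `p₂` to be Euclidean, as in the theorems of Blaschke and
Kakutani; by the symmetry of the hypothesis so is `p₁`.

The argument for a norm with normal complements goes as follows. Let the norm be differentiable at
`u`, with derivative `f`. When a plane through `u` rotates about `u`, its complementary direction
stays in `ker f`, and it is tangent both to the section of the unit ball by `ker f` and to all
parallel sections. Curves with the same tangent directions are homothetic, so parallel sections are
symmetric about the line through `u` (`norm_add_eq_norm_sub_of_apply_eq_zero`), and the linear map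
that fixes `u` and is `-1` on `ker f` is an isometry, a half-turn (`norm_halfTurn`). There is an inner product invariant
under all linear isometries (`exists_invariant_form`), for which these maps are the orthogonal
half-turns. Points of differentiability are dense, so by continuity all orthogonal half-turns are
isometries. Since the half-turn about `x + y` exchanges any two vectors `x`, `y` of equal Euclidean
length, the norm is a multiple of the Euclidean one (`exists_norm_sq_eq_form`).

Finally two Euclidean norms with the same orthogonality relation are proportional, because `x` and
`y` have equal length if and only if `x + y` and `x - y` are orthogonal. For the converse, an affine
isomorphism between centrally symmetric bodies maps centre to centre
(`apply_eq_of_closedBall_eq_image`), so homothetic ellipsoids belong to proportional Euclidean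
norms, for which normality is orthogonality.
-/

namespace NormalityReversal

open MeasureTheory Module Filter Topology

/-! ### A telescoping criterion for constancy -/

/-- If the increments of `h` over short intervals are bounded by the increments of some function `m`
times the length of the interval, then `h` is constant: over a subdivision into `n` equal parts the
bounds telescope to `C * (m b - m a) * (b - a) / n`. No regularity of `m` is needed. -/
theorem eq_of_abs_sub_le_mul_sub {h m : ℝ → ℝ} {a b C δ : ℝ} (hab : a ≤ b) (hδ : 0 < δ)
    (H : ∀ x ∈ Set.Icc a b, ∀ z ∈ Set.Icc a b, x ≤ z → z - x ≤ δ →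
      |h z - h x| ≤ C * (m z - m x) * (z - x)) : h a = h b := by
  have key : ∀ n : ℕ, 0 < n → (b - a) / n ≤ δ → |h b - h a| ≤ C * (m b - m a) * (b - a) / n := by
    intro n hn hnδ
    have hn' : (0 : ℝ) < n := by exact_mod_cast hn
    set d : ℝ := (b - a) / n with hd
    have hd0 : 0 ≤ d := div_nonneg (by linarith) hn'.le
    have hdn : n * d = b - a := by rw [hd]; field_simp
    have hmem : ∀ i : ℕ, i ≤ n → a + i * d ∈ Set.Icc a b := by
      intro i hi
      have hi' : (i : ℝ) ≤ n := by exact_mod_cast hi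
      have : (i : ℝ) * d ≤ n * d := mul_le_mul_of_nonneg_right hi' hd0
      exact ⟨by have : 0 ≤ (i : ℝ) * d := by positivity
                linarith, by linarith⟩
    have step : ∀ i ∈ Finset.range n, |h (a + (i + 1 : ℕ) * d) - h (a + i * d)|
        ≤ C * d * (m (a + (i + 1 : ℕ) * d) - m (a + i * d)) := by
      intro i hi
      have hi := Finset.mem_range.1 hi
      have e : (a + (i + 1 : ℕ) * d) - (a + i * d) = d := by push_cast; ring
      have := H _ (hmem i hi.le) _ (hmem (i + 1) hi) (by linarith) (by linarith)
      rw [e] at this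
      linarith
    have h1 := Finset.sum_range_sub (fun i : ℕ => h (a + i * d)) n
    have h2 := Finset.sum_range_sub (fun i : ℕ => m (a + i * d)) n
    have e1 : a + n * d = b := by linarith
    simp only [e1, Nat.cast_zero, zero_mul, add_zero] at h1 h2
    calc |h b - h a| ≤ ∑ i ∈ Finset.range n, |h (a + (i + 1 : ℕ) * d) - h (a + i * d)| := by
          rw [← h1]; exact Finset.abs_sum_le_sum_abs _ _
      _ ≤ ∑ i ∈ Finset.range n, C * d * (m (a + (i + 1 : ℕ) * d) - m (a + i * d)) :=
          Finset.sum_le_sum step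
      _ = C * (m b - m a) * (b - a) / n := by rw [← Finset.mul_sum, h2, hd]; ring
  have lim (c : ℝ) : Tendsto (fun n : ℕ => c / (n : ℝ)) atTop (𝓝 0) :=
    tendsto_const_div_atTop_nhds_zero_nat c
  have h0 : |h b - h a| ≤ 0 := by
    refine ge_of_tendsto (lim (C * (m b - m a) * (b - a))) ?_
    filter_upwards [(lim (b - a)).eventually (eventually_le_nhds hδ), eventually_gt_atTop 0]
      with n h1 h2 using key n h2 h1
  have := abs_eq_zero.1 (le_antisymm h0 (abs_nonneg _))
  linarith

/-! ### Normal complements of planes -/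

/-- For a norm `q`: whenever `v` is not in the plane `P` spanned by `u` and `w`, some translate
`v'` of `v` by an element of `P` is such that every element of `P` is normal to `v'`, that is, the
projection of `P + ℝ v'` onto `P` along `v'` does not increase `q`. The definition only uses the
values of `q`, so that it applies both to seminorms and to the norm of a normed space. -/
def HasNormalComplements {X : Type*} [AddCommGroup X] [Module ℝ X] (q : X → ℝ) : Prop :=
  ∀ u w v : X, v ∉ Submodule.span ℝ {u, w} →
    ∃ a b : ℝ, ∀ α β t : ℝ, q (α • u + β • w) ≤ q (α • u + β • w + t • (v - a • u - b • w))

section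
variable {V : Type*} [NormedAddCommGroup V] [NormedSpace ℝ V]

/-- Subtracting from `v` its nearest point in the plane spanned by `u` and `w` gives a vector normal
to that plane. -/
theorem exists_forall_norm_sub_le (u w v : V) :
    ∃ a b : ℝ, ∀ α β : ℝ,
      ‖v - a • u - b • w‖ ≤ ‖v - a • u - b • w + (α • u + β • w)‖ := by
  set P := Submodule.span ℝ {u, w}
  have : FiniteDimensional ℝ P := FiniteDimensional.span_of_finite ℝ (by simp)
  have hP : IsClosed (P : Set V) := P.closed_of_finiteDimensional
  obtain ⟨y, hy⟩ : ∃ y : P, ∀ z : P, ‖v - y‖ ≤ ‖v - z‖ := by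
    have hc : Continuous fun z : P => ‖v - z‖ := by fun_prop
    refine hc.exists_forall_le ?_
    have h1 : Tendsto (fun z : P => ‖z‖ - ‖v‖) (cocompact P) atTop :=
      tendsto_atTop_add_const_right _ _ (tendsto_norm_cocompact_atTop)
    refine tendsto_atTop_mono (fun z => ?_) h1
    have := norm_sub_norm_le (z : V) v
    rw [norm_sub_rev] at this
    exact this
  obtain ⟨a, b, hab⟩ := Submodule.mem_span_pair.1 y.2
  refine ⟨a, b, fun α β => ?_⟩
  have := hy (y - ⟨α • u + β • w, Submodule.mem_span_pair.2 ⟨α, β, rfl⟩⟩)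
  rw [← hab] at this
  simp only [AddSubgroupClass.coe_sub, ← hab] at this
  convert this using 2 <;> abel

/-! ### Half-turns about points of differentiability -/

theorem fderiv_norm_apply_self {u : V} (hu : DifferentiableAt ℝ (‖·‖) u) :
    fderiv ℝ (‖·‖) u u = ‖u‖ := by
  have h1 : HasDerivAt (fun t : ℝ => ‖u + t • u‖) (fderiv ℝ (‖·‖) u u) 0 := by
    have := (hu.hasFDerivAt.hasLineDerivAt u)
    exact this
  have h2 : HasDerivAt (fun t : ℝ => (1 + t) * ‖u‖) (1 * ‖u‖) 0 :=
    ((hasDerivAt_id (0 : ℝ)).const_add 1).mul_const _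
  have h3 : (fun t : ℝ => ‖u + t • u‖) =ᶠ[𝓝 0] fun t : ℝ => (1 + t) * ‖u‖ := by
    filter_upwards [eventually_gt_nhds (show (-1 : ℝ) < 0 by norm_num)] with t ht
    have : u + t • u = (1 + t) • u := by module
    rw [this, norm_smul, Real.norm_of_nonneg (by linarith)]
  rw [one_mul] at h2
  exact h1.unique (h2.congr_of_eventuallyEq h3)

theorem fderiv_norm_apply_eq_zero {u v : V} (hu : DifferentiableAt ℝ (‖·‖) u)
    (h : ∀ t : ℝ, ‖u‖ ≤ ‖u + t • v‖) : fderiv ℝ (‖·‖) u v = 0 := by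
  have h1 : HasDerivAt (fun t : ℝ => ‖u + t • v‖) (fderiv ℝ (‖·‖) u v) 0 :=
    hu.hasFDerivAt.hasLineDerivAt v
  refine IsLocalMin.hasDerivAt_eq_zero (Eventually.of_forall fun t => ?_) h1
  simpa using h t

/-- Let the norm be differentiable at `u` with derivative `f`. If `e` lies in `ker f` then
`‖u + e‖ = ‖u - e‖`.

Take `e'` in `ker f` independent of `e`. The points of `ker f` in the direction `x • e + e'` and of
norm one run, as `x` goes from `-∞` to `∞`, over an open arc joining `-e / ‖e‖` to `e / ‖e‖`. For the
plane spanned by `u` and `x • e + e'` there is a direction to which the whole plane is normal.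
Differentiability at `u` puts this direction in `ker f`, so it is tangent to the arc. As it is also
tangent to the level sets of `w ↦ ‖r • u + w‖` on `ker f`, that function is constant along the arc.
The arc need not be smooth, and the infinitesimal argument is replaced by the telescoping
criterion, applied with the subgradients of the convex function `x ↦ ‖x • e + e'‖`. -/
theorem norm_add_eq_norm_sub_of_apply_eq_zero (hV : HasNormalComplements (fun x : V => ‖x‖)) {u : V}
    (hu0 : u ≠ 0)
    (hu : DifferentiableAt ℝ (‖·‖) u) {e e' : V} (he : fderiv ℝ (‖·‖) u e = 0)
    (he' : fderiv ℝ (‖·‖) u e' = 0) (hi : LinearIndependent ℝ ![e, e']) :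
    ‖u + e‖ = ‖u - e‖ := by
  set f := fderiv ℝ (‖·‖) u with hf
  have hfu : f u = ‖u‖ := fderiv_norm_apply_self hu
  have hfu0 : f u ≠ 0 := by rw [hfu]; exact norm_ne_zero_iff.2 hu0
  have hi' : ∀ s t : ℝ, s • e + t • e' = 0 → s = 0 ∧ t = 0 := LinearIndependent.pair_iff.1 hi
  have he0 : e ≠ 0 := by
    rintro rfl
    exact one_ne_zero (hi' 1 0 (by simp)).1
  have hw0 : ∀ x : ℝ, x • e + e' ≠ 0 := fun x h =>
    one_ne_zero (hi' x 1 (by simpa using h)).2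
  set φ : ℝ → ℝ := fun x => ‖x • e + e'‖ with hφ
  have hφ0 : ∀ x, 0 < φ x := fun x => norm_pos_iff.2 (hw0 x)
  have hφc : Continuous φ := by fun_prop
  -- The direction to which `u` and `w = x • e + e'` are normal can be taken to be `e - k • w`: its
  -- component along `u` vanishes because it lies in `ker f`.
  have hk : ∀ x : ℝ, ∃ k : ℝ, ∀ α β t : ℝ, ‖α • u + β • (x • e + e')‖ ≤
      ‖α • u + β • (x • e + e') + t • (e - k • (x • e + e'))‖ := by
    intro x
    have hv : e ∉ Submodule.span ℝ {u, x • e + e'} := by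
      intro h
      obtain ⟨a, b, hab⟩ := Submodule.mem_span_pair.1 h
      have h1 := congrArg f hab
      simp only [map_add, map_smul, he, he', smul_eq_mul, mul_zero, add_zero] at h1
      have ha : a = 0 := by simpa [hfu0] using h1
      have := hi' (b * x - 1) b (by
        rw [ha] at hab
        have : (b * x - 1) • e + b • e' = (0 : ℝ) • u + b • (x • e + e') - e := by module
        rw [this, hab, sub_self])
      have hb := this.2
      have := this.1
      rw [hb] at this
      norm_num at this
    obtain ⟨a, b, hab⟩ := hV u (x • e + e') e hv
    have h1 : f (e - a • u - b • (x • e + e')) = 0 :=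
      fderiv_norm_apply_eq_zero hu fun t => by simpa using hab 1 0 t
    have ha : a = 0 := by
      simp only [map_add, map_sub, map_smul, he, he', smul_eq_mul, mul_zero, add_zero,
        sub_zero, zero_sub, neg_eq_zero] at h1
      simpa [hfu0] using h1
    refine ⟨b, fun α β t => ?_⟩
    simpa [ha] using hab α β t
  choose k hk using hk
  -- Hence `φ x * k x` is a subgradient of `φ` at `x`.
  have hsub : ∀ x z : ℝ, φ x * (1 + k x * (z - x)) ≤ φ z := by
    intro x z
    rcases le_or_gt (1 + k x * (z - x)) 0 with h | h
    · exact (mul_nonpos_of_nonneg_of_nonpos (hφ0 x).le h).trans (hφ0 z).le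
    · have h1 := hk x 0 (1 + k x * (z - x)) (z - x)
      have e1 : (0 : ℝ) • u + (1 + k x * (z - x)) • (x • e + e') =
          (1 + k x * (z - x)) • (x • e + e') := by module
      have e2 : (0 : ℝ) • u + (1 + k x * (z - x)) • (x • e + e') + (z - x) • (e - k x • (x • e + e'))
          = z • e + e' := by module
      rw [e2, e1, norm_smul, Real.norm_of_nonneg h.le, mul_comm] at h1
      exact h1
  -- The multiple of `u` is chosen such that the ends of the arc give multiples of `u ± e`.
  set r : ℝ := ‖e‖⁻¹ with hr
  set h : ℝ → ℝ := fun x => ‖r • u + (φ x)⁻¹ • (x • e + e')‖ with hh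
  -- The tangent line at the point of the arc with parameter `x` meets the ray through the point with
  -- parameter `z` at `lam` times the latter.
  have hstep : ∀ x z : ℝ, 0 < 1 + k x * (z - x) →
      h x - h z ≤ φ z / (φ x * (1 + k x * (z - x))) - 1 := by
    intro x z hp
    set lam := φ z / (φ x * (1 + k x * (z - x))) with hlam
    have hq := mul_pos (hφ0 x) hp
    have hlam1 : 1 ≤ lam := (one_le_div hq).2 (hsub x z)
    have h1 := hk x r (φ x)⁻¹ ((z - x) / (φ x * (1 + k x * (z - x))))
    have e2 : r • u + (φ x)⁻¹ • (x • e + e') +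
        ((z - x) / (φ x * (1 + k x * (z - x)))) • (e - k x • (x • e + e'))
        = (r • u + (φ z)⁻¹ • (z • e + e')) + (lam - 1) • ((φ z)⁻¹ • (z • e + e')) := by
      have a1 : lam * (φ z)⁻¹ = (φ x * (1 + k x * (z - x)))⁻¹ := by
        rw [hlam, div_eq_mul_inv, mul_right_comm, mul_inv_cancel₀ (hφ0 z).ne', one_mul]
      have a2 : (φ x)⁻¹ = (φ x * (1 + k x * (z - x)))⁻¹ * (1 + k x * (z - x)) := by
        rw [mul_inv, inv_mul_cancel_right₀ hp.ne']
      have a3 : (r • u + (φ z)⁻¹ • (z • e + e')) + (lam - 1) • ((φ z)⁻¹ • (z • e + e'))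
          = r • u + (lam * (φ z)⁻¹) • (z • e + e') := by module
      rw [a3, a1, a2, div_eq_mul_inv]
      module
    rw [e2] at h1
    have h2 : ‖(φ z)⁻¹ • (z • e + e')‖ = 1 := by
      rw [norm_smul, norm_inv, Real.norm_of_nonneg (hφ0 z).le]
      exact inv_mul_cancel₀ (hφ0 z).ne'
    have h3 := norm_add_le (r • u + (φ z)⁻¹ • (z • e + e')) ((lam - 1) • ((φ z)⁻¹ • (z • e + e')))
    rw [norm_smul, h2, Real.norm_of_nonneg (by linarith)] at h3
    simp only [hh]
    linarith
  have hconst : ∀ a b : ℝ, a ≤ b → h a = h b := by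
    intro a b hab
    obtain ⟨x₀, -, hx₀⟩ := isCompact_Icc.exists_isMinOn (Set.nonempty_Icc.2 hab) hφc.continuousOn
    set c := φ x₀
    have hc : 0 < c := hφ0 x₀
    have hE : 0 < ‖e‖ := norm_pos_iff.2 he0
    -- `φ` is Lipschitz with constant `‖e‖`, which bounds its subgradients.
    have hkb : ∀ x, |k x| * φ x ≤ ‖e‖ := by
      intro x
      have l1 : ∀ z, φ z ≤ φ x + |z - x| * ‖e‖ := by
        intro z
        have : z • e + e' = (x • e + e') + (z - x) • e := by module
        simp only [hφ]
        rw [this]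
        refine (norm_add_le _ _).trans ?_
        rw [norm_smul, Real.norm_eq_abs]
      have l2 := (hsub x (x + 1)).trans (l1 (x + 1))
      have l3 := (hsub x (x - 1)).trans (l1 (x - 1))
      norm_num at l2 l3
      rcases abs_cases (k x) with ⟨r, -⟩ | ⟨r, -⟩ <;> rw [r] <;> nlinarith
    refine eq_of_abs_sub_le_mul_sub (m := fun x => φ x * k x) (C := 2 / c) (δ := c / (2 * ‖e‖))
      hab (by positivity) ?_
    have main : ∀ x ∈ Set.Icc a b, ∀ z ∈ Set.Icc a b, |z - x| ≤ c / (2 * ‖e‖) →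
        h x - h z ≤ 2 / c * (φ z * k z - φ x * k x) * (z - x) := by
      intro x hx z hz hxz
      have cx : c ≤ φ x := hx₀ hx
      have i1 : φ x / 2 ≤ φ x * (1 + k x * (z - x)) := by
        have : |k x * φ x * (z - x)| ≤ c / 2 := by
          rw [abs_mul, abs_mul, abs_of_pos (hφ0 x)]
          calc |k x| * φ x * |z - x| ≤ ‖e‖ * (c / (2 * ‖e‖)) :=
                mul_le_mul (hkb x) hxz (abs_nonneg _) hE.le
            _ = c / 2 := by field_simp
        have := (abs_le.1 this).1
        nlinarith
      have i2 : 0 < 1 + k x * (z - x) := by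
        have : 0 < φ x * (1 + k x * (z - x)) := by linarith
        exact (pos_iff_pos_of_mul_pos this).1 (hφ0 x)
      have i3 := hstep x z i2
      have i4 := hsub z x
      have hq := mul_pos (hφ0 x) i2
      have i5 : φ z / (φ x * (1 + k x * (z - x))) - 1 =
          (φ z - φ x * (1 + k x * (z - x))) / (φ x * (1 + k x * (z - x))) :=
        div_sub_one hq.ne'
      have i6 : 0 ≤ φ z - φ x * (1 + k x * (z - x)) := by linarith [hsub x z]
      have i7 : φ z - φ x * (1 + k x * (z - x)) ≤ (φ z * k z - φ x * k x) * (z - x) := by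
        nlinarith
      rw [i5] at i3
      refine i3.trans ?_
      calc _ ≤ (φ z - φ x * (1 + k x * (z - x))) / (c / 2) :=
            div_le_div_of_nonneg_left i6 (by positivity) (by linarith)
        _ = 2 / c * (φ z - φ x * (1 + k x * (z - x))) := by field_simp
        _ ≤ 2 / c * ((φ z * k z - φ x * k x) * (z - x)) :=
            mul_le_mul_of_nonneg_left i7 (by positivity)
        _ = _ := by ring
    intro x hx z hz hxz hd
    have m1 := main x hx z hz (by rwa [abs_of_nonneg (by linarith)])
    have m2 := main z hz x hx (by rw [abs_sub_comm]; rwa [abs_of_nonneg (by linarith)])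
    rw [abs_le]
    constructor <;> linarith
  -- The two ends of the arc are `σ • e / ‖e‖` with `σ = ± 1`.
  have hlim : ∀ σ : ℝ, |σ| = 1 → Tendsto (fun n : ℕ => h (σ * n)) atTop
      (𝓝 ‖r • u + (‖e‖)⁻¹ • (σ • e)‖) := by
    intro σ hσ
    have t1 : Tendsto (fun n : ℕ => (n : ℝ)⁻¹) atTop (𝓝 0) := tendsto_inv_atTop_nhds_zero_nat
    have t2 : Tendsto (fun n : ℕ => σ • e + (n : ℝ)⁻¹ • e') atTop (𝓝 (σ • e)) := by
      simpa using (t1.smul_const e').const_add (σ • e)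
    have hσe : ‖σ • e‖ = ‖e‖ := by rw [norm_smul, Real.norm_eq_abs, hσ, one_mul]
    have t3 : Tendsto (fun n : ℕ => ‖r • u + ‖σ • e + (n : ℝ)⁻¹ • e'‖⁻¹ • (σ • e + (n : ℝ)⁻¹ • e')‖)
        atTop (𝓝 ‖r • u + (‖σ • e‖)⁻¹ • (σ • e)‖) :=
      (((t2.norm.inv₀ (by rw [hσe]; exact norm_ne_zero_iff.2 he0)).smul t2).const_add (r • u)).norm
    rw [hσe] at t3
    refine t3.congr' ?_
    filter_upwards [eventually_gt_atTop 0] with n hn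
    have hn' : (0 : ℝ) < n := by exact_mod_cast hn
    have : (σ * n) • e + e' = (n : ℝ) • (σ • e + (n : ℝ)⁻¹ • e') := by
      match_scalars <;> field_simp
    simp only [hh, hφ]
    rw [this, norm_smul, Real.norm_of_nonneg hn'.le, smul_smul, mul_inv, mul_right_comm,
      inv_mul_cancel₀ hn'.ne', one_mul]
  have l1 := hlim 1 (by simp)
  have l2 := hlim (-1) (by simp)
  have l3 : ∀ n : ℕ, h (-1 * n) = h (1 * n) := fun n => hconst _ _ (by
    have : (0 : ℝ) ≤ n := n.cast_nonneg
    linarith)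
  have l4 := tendsto_nhds_unique (l2.congr l3) l1
  have hr0 : 0 < r := inv_pos.2 (norm_pos_iff.2 he0)
  have e1 : r • u + ‖e‖⁻¹ • ((-1 : ℝ) • e) = r • (u - e) := by rw [← hr]; module
  have e2 : r • u + ‖e‖⁻¹ • ((1 : ℝ) • e) = r • (u + e) := by rw [← hr]; module
  rw [e1, e2, norm_smul, norm_smul] at l4
  exact (mul_left_cancel₀ (norm_ne_zero_iff.2 hr0.ne') l4).symm

/-- The half-turn about the line through a point of differentiability `u`, which is the identity on
that line and `-1` on the kernel of the derivative, is an isometry. The dimension is at least three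
so that this kernel contains two independent vectors. -/
theorem norm_halfTurn [FiniteDimensional ℝ V] (hdim : 2 < finrank ℝ V)
    (hV : HasNormalComplements (fun x : V => ‖x‖)) {u : V} (hu0 : u ≠ 0)
    (hu : DifferentiableAt ℝ (‖·‖) u) (v : V) :
    ‖(2 * (fderiv ℝ (‖·‖) u v / ‖u‖)) • u - v‖ = ‖v‖ := by
  set f := fderiv ℝ (‖·‖) u with hf
  have hfu : f u = ‖u‖ := fderiv_norm_apply_self hu
  have hu0' : ‖u‖ ≠ 0 := norm_ne_zero_iff.2 hu0
  set s := f v / ‖u‖ with hs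
  set e := v - s • u with he
  have hfe : f e = 0 := by
    rw [he, map_sub, map_smul, hfu, hs, smul_eq_mul, div_mul_cancel₀ _ hu0', sub_self]
  by_cases he0 : e = 0
  · have : v = s • u := by rwa [he, sub_eq_zero] at he0
    rw [this]; congr 1; module
  have e1 : (2 * s) • u - v = s • u - e := by rw [he]; module
  have e2 : v = s • u + e := by rw [he]; module
  by_cases hs0 : s = 0
  · rw [hs0]; simp
  obtain ⟨e', he'f, he'⟩ : ∃ e' : V, f e' = 0 ∧ e' ∉ Submodule.span ℝ {e} := by
    by_contra! hcon
    have hle : LinearMap.ker (f : V →ₗ[ℝ] ℝ) ≤ Submodule.span ℝ {e} := fun x hx => hcon x hx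
    have h1 := Submodule.finrank_mono hle
    have h2 := finrank_span_le_card (R := ℝ) ({e} : Set V)
    have h3 := LinearMap.finrank_range_add_finrank_ker (f : V →ₗ[ℝ] ℝ)
    have h4 := Submodule.finrank_le (LinearMap.range (f : V →ₗ[ℝ] ℝ))
    simp at h2 h4
    omega
  have hi : ∀ c : ℝ, c ≠ 0 → LinearIndependent ℝ ![c • e, e'] := by
    intro c hc
    rw [LinearIndependent.pair_iff' (smul_ne_zero hc he0)]
    intro a ha
    refine he' (Submodule.mem_span_singleton.2 ⟨a * c, ?_⟩)
    rw [← ha, smul_smul]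
  have := norm_add_eq_norm_sub_of_apply_eq_zero hV hu0 hu (e := s⁻¹ • e) (e' := e')
    (by rw [← hf, map_smul, hfe, smul_zero]) he'f (hi _ (inv_ne_zero hs0))
  have e3 : s • u + e = s • (u + s⁻¹ • e) := by rw [smul_add, smul_inv_smul₀ hs0]
  have e4 : s • u - e = s • (u - s⁻¹ • e) := by rw [smul_sub, smul_inv_smul₀ hs0]
  rw [e1]
  conv_rhs => rw [e2]
  rw [e3, e4, norm_smul, norm_smul, this]

/-! ### An inner product invariant under all isometries -/

/-- Every finite dimensional normed space has an inner product invariant under all linear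
isometries: `B x y = ∫ f x * f y` over the unit ball of the dual space. The Hausdorff measure on
the dual is a Haar measure and is visibly invariant under isometries. -/
theorem exists_invariant_form [FiniteDimensional ℝ V] :
    ∃ B : V →ₗ[ℝ] V →ₗ[ℝ] ℝ, (∀ x y, B x y = B y x) ∧ (∀ x, x ≠ 0 → 0 < B x x) ∧
      ∀ (T : V →ₗᵢ[ℝ] V) (x y : V), B (T x) (T y) = B x y := by
  let D := StrongDual ℝ V
  let _ : MeasurableSpace D := borel D
  have : BorelSpace D := ⟨rfl⟩
  let μ : Measure D := μH[finrank ℝ D]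
  let K : Set D := Metric.closedBall 0 1
  have hK : IsCompact K := isCompact_closedBall _ _
  have hev (x : V) : Continuous fun f : D => f x := by fun_prop
  have hint (x y : V) : IntegrableOn (fun f : D => f x * f y) K μ :=
    ((hev x).mul (hev y)).continuousOn.integrableOn_compact hK
  let B : V →ₗ[ℝ] V →ₗ[ℝ] ℝ := LinearMap.mk₂ ℝ (fun x y => ∫ f in K, f x * f y ∂μ)
    (fun x x' y => by
      simp only [map_add, add_mul]
      exact integral_add (hint x y) (hint x' y))
    (fun c x y => by
      simp only [map_smul, smul_eq_mul, mul_assoc]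
      exact integral_const_mul c _)
    (fun x y y' => by
      simp only [map_add, mul_add]
      exact integral_add (hint x y) (hint x y'))
    (fun c x y => by
      simp only [map_smul, smul_eq_mul, mul_left_comm _ c]
      exact integral_const_mul c _)
  have hB (x y : V) : B x y = ∫ f in K, f x * f y ∂μ := rfl
  refine ⟨B, fun x y => by simp only [hB, mul_comm], fun x hx => ?_, fun T x y => ?_⟩
  · rw [hB]
    rw [setIntegral_pos_iff_support_of_nonneg_ae
      (Eventually.of_forall fun f => mul_self_nonneg _) (hint x x)]
    obtain ⟨g, hg1, hg⟩ := exists_dual_vector ℝ x (norm_ne_zero_iff.2 hx)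
    have hopen : IsOpen ({f : D | f x ≠ 0} ∩ Metric.ball 0 1) :=
      (isOpen_ne_fun (hev x) continuous_const).inter Metric.isOpen_ball
    have hne : ({f : D | f x ≠ 0} ∩ Metric.ball 0 1).Nonempty := by
      refine ⟨(2⁻¹ : ℝ) • g, ?_, ?_⟩
      · have : g x ≠ 0 := by rw [hg]; simpa using hx
        simpa using this
      · rw [mem_ball_zero_iff, norm_smul, hg1]; norm_num
    refine (hopen.measure_pos μ hne).trans_le (measure_mono ?_)
    rintro f ⟨h1, h2⟩
    exact ⟨mul_ne_zero h1 h1, Metric.ball_subset_closedBall h2⟩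
  · let T' : V ≃ₗᵢ[ℝ] V := T.toLinearIsometryEquiv rfl
    let S : D ≃ᵢ D := IsometryEquiv.mk' (fun f => f.comp (T' : V →L[ℝ] V))
      (fun f => f.comp (T'.symm : V →L[ℝ] V))
      (fun f => by ext z; simp)
      (Isometry.of_dist_eq fun f g => by
        rw [dist_eq_norm, dist_eq_norm, ← ContinuousLinearMap.sub_comp]
        exact ContinuousLinearMap.opNorm_comp_linearIsometryEquiv _ T')
    have hS : MeasurePreserving S μ μ := S.measurePreserving_hausdorffMeasure _
    have hSK : S ⁻¹' K = K := by
      ext f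
      have : ‖S f‖ = ‖f‖ := ContinuousLinearMap.opNorm_comp_linearIsometryEquiv f T'
      rw [Set.mem_preimage, mem_closedBall_zero_iff, mem_closedBall_zero_iff, this]
    have := hS.setIntegral_preimage_emb S.toHomeomorph.measurableEmbedding
      (fun f => f x * f y) K
    rw [hSK] at this
    rw [hB, hB, ← this]
    rfl

/-! ### Transitivity on the sphere -/

/-- In dimension at least three, a norm with normal complements of planes comes from a bilinear
form. -/
theorem exists_norm_sq_eq_form [FiniteDimensional ℝ V] (hdim : 2 < finrank ℝ V)
    (hV : HasNormalComplements (fun x : V => ‖x‖)) :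
    ∃ B : V →ₗ[ℝ] V →ₗ[ℝ] ℝ, ∀ x, ‖x‖ ^ 2 = B x x := by
  obtain ⟨B, hsymm, hpos, hinv⟩ := exists_invariant_form (V := V)
  have hB0 : ∀ x, 0 ≤ B x x := fun x => by
    by_cases h : x = 0
    · simp [h]
    · exact (hpos x h).le
  have hBc (x y : V → V) (hx : Continuous x) (hy : Continuous y) :
      Continuous fun v => B (x v) (y v) := by
    have : Continuous fun v => B.toContinuousBilinearMap (x v) (y v) := by fun_prop
    exact this
  -- At a point of differentiability the half-turn preserves `B`, so it is the half-turn defined by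
  -- `B`; multiplying by `B s s` avoids the division.
  have hdiff : ∀ s v : V, s ≠ 0 → DifferentiableAt ℝ (‖·‖) s →
      ‖(2 * B s v) • s - (B s s) • v‖ = B s s * ‖v‖ := by
    intro s v hs hd
    set f := fderiv ℝ (‖·‖) s with hf
    let T : V →ₗᵢ[ℝ] V :=
      { toLinearMap := (LinearMap.toSpanSingleton ℝ V s).comp ((2 / ‖s‖) • (f : V →ₗ[ℝ] ℝ))
          - LinearMap.id
        norm_map' := fun v => by
          have := norm_halfTurn hdim hV hs hd v
          rw [← this]
          congr 1
          simp [← hf, mul_div_assoc, div_mul_eq_mul_div] }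
    have hT (v : V) : T v = (2 * (f v / ‖s‖)) • s - v := by
      change ((2 / ‖s‖) * f v) • s - v = _
      congr 2; ring
    have hs0 : ‖s‖ ≠ 0 := norm_ne_zero_iff.2 hs
    have hTs : T s = s := by
      rw [hT, hf, fderiv_norm_apply_self hd, div_self hs0]; module
    have h1 := hinv T s v
    rw [hTs, hT, map_sub, map_smul, smul_eq_mul] at h1
    have h2 : f v / ‖s‖ * B s s = B s v := by linarith
    have h3 : (2 * B s v) • s - (B s s) • v = (B s s) • T v := by
      rw [hT, ← h2]; module
    rw [h3, norm_smul, T.norm_map, Real.norm_of_nonneg (hB0 s)]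
  -- The norm is differentiable on a dense set, and both sides are continuous in `s`.
  have hall : ∀ s v : V, ‖(2 * B s v) • s - (B s s) • v‖ = B s s * ‖v‖ := by
    intro s v
    have hd : Dense {s : V | DifferentiableAt ℝ (‖·‖) s} := dense_differentiableAt_norm
    have c1 := hBc id id continuous_id continuous_id
    have c2 := hBc id (fun _ => v) continuous_id continuous_const
    refine congrFun (Continuous.ext_on hd (f := fun s => ‖(2 * B s v) • s - (B s s) • v‖)
      (g := fun s => B s s * ‖v‖) ?_ ?_ ?_) s
    · exact (((continuous_const.mul c2).smul continuous_id).sub (c1.smul continuous_const)).norm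
    · exact c1.mul continuous_const
    · intro s hs
      by_cases h0 : s = 0
      · simp [h0]
      · exact hdiff s v h0 hs
  -- The half-turn about `x + y` exchanges `x` and `y`.
  have heq : ∀ x y : V, B x x = B y y → ‖x‖ = ‖y‖ := by
    intro x y hxy
    by_cases h0 : x + y = 0
    · rw [eq_neg_of_add_eq_zero_left h0, norm_neg]
    have h1 := hall (x + y) x
    have hp := hpos _ h0
    have h2 : 2 * B (x + y) x = B (x + y) (x + y) := by
      simp only [map_add, LinearMap.add_apply]
      linarith [hsymm x y]
    rw [h2, ← smul_sub, add_sub_cancel_left, norm_smul, Real.norm_of_nonneg hp.le] at h1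
    exact (mul_left_cancel₀ hp.ne' h1).symm
  have : Nontrivial V := Module.nontrivial_of_finrank_pos (R := ℝ) (by omega)
  obtain ⟨x₀, hx₀⟩ := exists_ne (0 : V)
  have hp₀ := hpos x₀ hx₀
  refine ⟨(‖x₀‖ ^ 2 / B x₀ x₀) • B, fun x => ?_⟩
  have h1 : ‖x‖ = ‖Real.sqrt (B x x / B x₀ x₀) • x₀‖ := by
    apply heq
    simp only [map_smul, LinearMap.smul_apply, smul_eq_mul]
    rw [← mul_assoc, Real.mul_self_sqrt (div_nonneg (hB0 x) hp₀.le), div_mul_cancel₀ _ hp₀.ne']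
  rw [h1, norm_smul, Real.norm_of_nonneg (Real.sqrt_nonneg _), mul_pow,
    Real.sq_sqrt (div_nonneg (hB0 x) hp₀.le)]
  simp only [LinearMap.smul_apply, smul_eq_mul]
  ring

end

section
variable {X : Type*} [AddCommGroup X] [Module ℝ X]

/-! ### Transfer to seminorms on a vector space -/

theorem normedSpaceCore (p : Seminorm ℝ X) (hp : ∀ x, p x = 0 → x = 0) :
    let _ : Norm X := ⟨p⟩
    NormedSpace.Core ℝ X :=
  let _ : Norm X := ⟨p⟩
  { norm_nonneg := apply_nonneg p
    norm_smul := map_smul_eq_mul p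
    norm_triangle := map_add_le_add p
    norm_eq_zero_iff := fun x => ⟨hp x, fun h => h ▸ map_zero p⟩ }

/-- A vector `p₁`-normal to a plane exists by taking nearest points, and the plane is `p₂`-normal to
it. -/
theorem hasNormalComplements_of_isNormalTo {p₁ p₂ : Seminorm ℝ X}
    (hp₁ : ∀ x, p₁ x = 0 → x = 0) (h : ∀ x y : X, IsNormalTo p₁ x y → IsNormalTo p₂ y x) :
    HasNormalComplements p₂ := by
  intro u w v hv
  let _ : Norm X := ⟨p₁⟩
  let _ : NormedAddCommGroup X := NormedAddCommGroup.ofCore (normedSpaceCore p₁ hp₁)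
  let _ : NormedSpace ℝ X := NormedSpace.ofCore (normedSpaceCore p₁ hp₁)
  obtain ⟨a, b, hab⟩ := exists_forall_norm_sub_le u w v
  refine ⟨a, b, fun α β t => ?_⟩
  by_cases hy : α • u + β • w = 0
  · rw [hy, map_zero]; exact apply_nonneg _ _
  refine (h (v - a • u - b • w) (α • u + β • w) ⟨fun h0 => hv ?_, hy, fun t => ?_⟩).2.2 t
  · exact Submodule.mem_span_pair.2 ⟨a, b, by rw [sub_sub, sub_eq_zero] at h0; exact h0.symm⟩
  · have := hab (t * α) (t * β)
    rwa [mul_smul, mul_smul, ← smul_add] at this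

theorem exists_seminorm_sq_eq_form [FiniteDimensional ℝ X] (hdim : 2 < finrank ℝ X)
    {p : Seminorm ℝ X} (hp : ∀ x, p x = 0 → x = 0) (h : HasNormalComplements p) :
    ∃ B : X →ₗ[ℝ] X →ₗ[ℝ] ℝ, ∀ x, p x ^ 2 = B x x :=
  let _ : Norm X := ⟨p⟩
  let _ : NormedAddCommGroup X := NormedAddCommGroup.ofCore (normedSpaceCore p hp)
  let _ : NormedSpace ℝ X := NormedSpace.ofCore (normedSpaceCore p hp)
  exists_norm_sq_eq_form hdim h

/-! ### Ellipsoids and quadratic forms -/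

theorem isEllipsoid_closedBall_of_sq_eq_form [FiniteDimensional ℝ X] {p : Seminorm ℝ X}
    (hp : ∀ x, p x = 0 → x = 0) {B : X →ₗ[ℝ] X →ₗ[ℝ] ℝ} (hB : ∀ x, p x ^ 2 = B x x) :
    IsEllipsoid (p.closedBall 0 1) := by
  let _ : Norm X := ⟨p⟩
  let _ : NormedAddCommGroup X := NormedAddCommGroup.ofCore (normedSpaceCore p hp)
  let _ : NormedSpace ℝ X := NormedSpace.ofCore (normedSpaceCore p hp)
  let _ : InnerProductSpace ℝ X := InnerProductSpace.ofNorm ℝ fun x y => by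
    change p (x + y) * p (x + y) + p (x - y) * p (x - y) = 2 * (p x * p x + p y * p y)
    simp only [← sq, hB, map_add, map_sub, LinearMap.add_apply, LinearMap.sub_apply]
    ring
  let e := (stdOrthonormalBasis ℝ X).repr.symm
  refine ⟨e.toLinearEquiv.toAffineEquiv, ?_⟩
  have h1 : p.closedBall 0 1 = Metric.closedBall (0 : X) 1 := by
    ext x
    rw [Seminorm.mem_closedBall_zero, mem_closedBall_zero_iff]
    rfl
  rw [h1]
  have := e.image_closedBall 0 1
  rw [map_zero] at this
  exact this.symm

theorem isNormalTo_iff_form_eq_zero {p : Seminorm ℝ X} {B : X →ₗ[ℝ] X →ₗ[ℝ] ℝ}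
    (hB : ∀ x, p x ^ 2 = B x x) (hs : ∀ x y, B x y = B y x) {x y : X} (hx : x ≠ 0) (hy : y ≠ 0) :
    IsNormalTo p x y ↔ B x y = 0 := by
  have key (t : ℝ) : p (x + t • y) ^ 2 = p x ^ 2 + (2 * t * B x y + t ^ 2 * B y y) := by
    rw [hB, hB]
    simp only [map_add, map_smul, LinearMap.add_apply, LinearMap.smul_apply, smul_eq_mul]
    rw [hs y x]; ring
  have hyy : 0 ≤ B y y := by rw [← hB]; positivity
  refine ⟨fun h => ?_, fun h => ⟨hx, hy, fun t => ?_⟩⟩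
  · have h1 : ∀ t : ℝ, 0 ≤ B y y * (t * t) + 2 * B x y * t + 0 := fun t => by
      have h2 := pow_le_pow_left₀ (apply_nonneg p x) (h.2.2 t) 2
      rw [key] at h2
      linarith
    have := discrim_le_zero h1
    rw [discrim] at this
    nlinarith [sq_nonneg (B x y)]
  · refine le_of_sq_le_sq ?_ (apply_nonneg _ _)
    rw [key, h]
    nlinarith [mul_nonneg (sq_nonneg t) hyy]

/-- The unit ball of a norm is not symmetric about any point other than the origin. Here `d` is
twice the centre of symmetry. -/
theorem eq_zero_of_forall_exists_add_eq {E : Type*} [AddCommGroup E] [Module ℝ E]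
    {p : Seminorm ℝ E} (hp : ∀ x, p x = 0 → x = 0) {d : E}
    (h : ∀ x, p x ≤ 1 → ∃ y, p y ≤ 1 ∧ x + y = d) : d = 0 := by
  by_contra hd
  have hd0 : 0 < p d := lt_of_le_of_ne (apply_nonneg p d) fun h => hd (hp d h.symm)
  obtain ⟨y, hy, hxy⟩ := h (-((p d)⁻¹ • d)) (by
    rw [map_neg_eq_map, map_smul_eq_mul, norm_inv, Real.norm_of_nonneg hd0.le,
      inv_mul_cancel₀ hd0.ne'])
  have h1 : y = (1 + (p d)⁻¹) • d := by
    rw [add_smul, one_smul, add_comm, eq_neg_add_of_add_eq hxy, neg_neg]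
  rw [h1, map_smul_eq_mul, Real.norm_of_nonneg (by positivity), add_mul, one_mul,
    inv_mul_cancel₀ hd0.ne'] at hy
  linarith

/-- An affine isomorphism mapping one unit ball onto another has no translation part, and its linear
part carries one norm to the other. -/
theorem apply_eq_of_closedBall_eq_image {E : Type*} [AddCommGroup E] [Module ℝ E]
    {p : Seminorm ℝ X} {q : Seminorm ℝ E} (hq : ∀ x, q x = 0 → x = 0) (L : E ≃ₗ[ℝ] X) (c : X)
    (h : p.closedBall 0 1 = (fun x => L x + c) '' q.closedBall 0 1) (x : E) : p (L x) = q x := by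
  have hmem (y : X) : p y ≤ 1 ↔ ∃ x, q x ≤ 1 ∧ L x + c = y := by
    rw [← p.mem_closedBall_zero, h]
    simp
  have hc : c = 0 := by
    have : L.symm (-(2 : ℝ) • c) = 0 := by
      refine eq_zero_of_forall_exists_add_eq hq fun x hx => ?_
      have h1 : p (-(L x + c)) ≤ 1 := by
        rw [map_neg_eq_map]
        exact (hmem _).2 ⟨x, hx, rfl⟩
      obtain ⟨y, hy, hxy⟩ := (hmem _).1 h1
      refine ⟨y, hy, ?_⟩
      rw [LinearEquiv.eq_symm_apply, map_add, eq_sub_of_add_eq hxy]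
      module
    simpa using this
  subst hc
  have hle (x : E) : p (L x) ≤ 1 ↔ q x ≤ 1 := by
    rw [hmem]
    simp
  have hle' (x : E) (r : ℝ) (hr : 0 < r) : p (L x) ≤ r ↔ q x ≤ r := by
    have := hle (r⁻¹ • x)
    rwa [map_smul, map_smul_eq_mul, map_smul_eq_mul, norm_inv, Real.norm_of_nonneg hr.le,
      inv_mul_le_one₀ hr, inv_mul_le_one₀ hr] at this
  refine le_antisymm ?_ ?_ <;> refine le_of_forall_pos_le_add fun ε hε => ?_
  · have := apply_nonneg q x
    exact (hle' x _ (by linarith)).2 (by linarith)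
  · have := apply_nonneg p (L x)
    exact (hle' x _ (by linarith)).1 (by linarith)

theorem exists_form_of_isEllipsoid {p : Seminorm ℝ X} (h : IsEllipsoid (p.closedBall 0 1)) :
    ∃ B : X →ₗ[ℝ] X →ₗ[ℝ] ℝ, (∀ x, p x ^ 2 = B x x) ∧ ∀ x y, B x y = B y x := by
  obtain ⟨f, hf⟩ := h
  have h1 := apply_eq_of_closedBall_eq_image (p := p)
    (q := normSeminorm ℝ (EuclideanSpace ℝ (Fin (finrank ℝ X))))
    (fun x hx => norm_eq_zero.1 hx) f.linear (f 0) (by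
      rw [hf]
      congr 1
      · funext x
        have := f.map_vadd 0 x
        simpa using this)
  refine ⟨(innerₗ (EuclideanSpace ℝ (Fin (finrank ℝ X)))).compl₁₂
    f.linear.symm.toLinearMap f.linear.symm.toLinearMap, fun x => ?_, fun x y => ?_⟩
  · have := h1 (f.linear.symm x)
    rw [LinearEquiv.apply_symm_apply] at this
    rw [this]
    exact (real_inner_self_eq_norm_sq (f.linear.symm x)).symm
  · exact real_inner_comm (f.linear.symm y) (f.linear.symm x)

/-! ### Proportionality of the two norms -/

theorem exists_eq_mul_of_isNormalTo [Nontrivial X] {p₁ p₂ : Seminorm ℝ X}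
    (hp₁ : ∀ x, p₁ x = 0 → x = 0) (hp₂ : ∀ x, p₂ x = 0 → x = 0)
    {B₁ B₂ : X →ₗ[ℝ] X →ₗ[ℝ] ℝ} (hB₁ : ∀ x, p₁ x ^ 2 = B₁ x x) (hs₁ : ∀ x y, B₁ x y = B₁ y x)
    (hB₂ : ∀ x, p₂ x ^ 2 = B₂ x x) (hs₂ : ∀ x y, B₂ x y = B₂ y x)
    (h : ∀ x y : X, IsNormalTo p₁ x y → IsNormalTo p₂ y x) :
    ∃ k : ℝ, 0 < k ∧ ∀ x, p₁ x = k * p₂ x := by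
  have hpos₁ (x : X) (hx : x ≠ 0) : 0 < p₁ x :=
    lt_of_le_of_ne (apply_nonneg _ _) fun h => hx (hp₁ x h.symm)
  have hpos₂ (x : X) (hx : x ≠ 0) : 0 < p₂ x :=
    lt_of_le_of_ne (apply_nonneg _ _) fun h => hx (hp₂ x h.symm)
  -- `x` and `y` have the same length exactly when `x + y` and `x - y` are orthogonal.
  have heq : ∀ x y, p₁ x = p₁ y → p₂ x = p₂ y := by
    intro x y hxy
    by_cases h1 : x + y = 0
    · rw [eq_neg_of_add_eq_zero_left h1, map_neg_eq_map]
    by_cases h2 : x - y = 0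
    · rw [sub_eq_zero.1 h2]
    have h3 := hB₁ x
    rw [hxy, hB₁ y] at h3
    have h4 := (isNormalTo_iff_form_eq_zero hB₂ hs₂ h2 h1).1 (h _ _
      ((isNormalTo_iff_form_eq_zero hB₁ hs₁ h1 h2).2 (by
        simp only [map_add, map_sub, LinearMap.add_apply]
        linarith [hs₁ x y])))
    simp only [map_add, map_sub, LinearMap.sub_apply] at h4
    rw [← sq_eq_sq₀ (apply_nonneg _ _) (apply_nonneg _ _), hB₂, hB₂]
    linarith [hs₂ x y]
  obtain ⟨x₀, hx₀⟩ := exists_ne (0 : X)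
  have q1 := hpos₁ x₀ hx₀
  have q2 := hpos₂ x₀ hx₀
  refine ⟨p₁ x₀ / p₂ x₀, div_pos q1 q2, fun x => ?_⟩
  have := heq x ((p₁ x / p₁ x₀) • x₀) (by
    rw [map_smul_eq_mul, Real.norm_of_nonneg (div_nonneg (apply_nonneg _ _) q1.le),
      div_mul_cancel₀ _ q1.ne'])
  rw [map_smul_eq_mul, Real.norm_of_nonneg (div_nonneg (apply_nonneg _ _) q1.le)] at this
  rw [this]
  field_simp

end

end NormalityReversal

open NormalityReversal in
theorem theorem3p2 {X : Type*} [AddCommGroup X] [Module ℝ X] [FiniteDimensional ℝ X]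
    (hdim : 2 < Module.finrank ℝ X) (p₁ p₂ : Seminorm ℝ X)
    (hp₁ : ∀ x : X, p₁ x = 0 → x = 0) (hp₂ : ∀ x : X, p₂ x = 0 → x = 0) :
    (∀ x y : X, IsNormalTo p₁ x y ↔ IsNormalTo p₂ y x) ↔
      (IsEllipsoid (p₁.closedBall 0 1) ∧ IsEllipsoid (p₂.closedBall 0 1) ∧
        AreHomothetic (p₁.closedBall 0 1) (p₂.closedBall 0 1)) := by
  constructor
  · intro h
    have : Nontrivial X := Module.nontrivial_of_finrank_pos (R := ℝ) (by omega)
    obtain ⟨C₁, hC₁⟩ := exists_seminorm_sq_eq_form hdim hp₁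
      (hasNormalComplements_of_isNormalTo hp₂ fun x y => (h y x).2)
    obtain ⟨C₂, hC₂⟩ := exists_seminorm_sq_eq_form hdim hp₂
      (hasNormalComplements_of_isNormalTo hp₁ fun x y => (h x y).1)
    have he₁ := isEllipsoid_closedBall_of_sq_eq_form hp₁ hC₁
    have he₂ := isEllipsoid_closedBall_of_sq_eq_form hp₂ hC₂
    refine ⟨he₁, he₂, ?_⟩
    -- The forms are taken from the ellipsoids again since these come with symmetry.
    obtain ⟨B₁, hB₁, hs₁⟩ := exists_form_of_isEllipsoid he₁
    obtain ⟨B₂, hB₂, hs₂⟩ := exists_form_of_isEllipsoid he₂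
    obtain ⟨k, hk, hkp⟩ := exists_eq_mul_of_isNormalTo hp₁ hp₂ hB₁ hs₁ hB₂ hs₂
      fun x y => (h x y).1
    refine ⟨k, 0, hk, ?_⟩
    ext x
    simp only [Seminorm.mem_closedBall_zero, Set.mem_image, add_zero]
    refine ⟨fun hx => ⟨k⁻¹ • x, ?_, smul_inv_smul₀ hk.ne' x⟩, ?_⟩
    · rw [map_smul_eq_mul, hkp, norm_inv, Real.norm_of_nonneg hk.le,
        inv_mul_cancel_left₀ hk.ne']
      exact hx
    · rintro ⟨y, hy, rfl⟩
      rw [map_smul_eq_mul, Real.norm_of_nonneg hk.le, ← hkp]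
      exact hy
  · rintro ⟨he₁, -, r, c, hr, hrc⟩ x y
    obtain ⟨B, hB, hs⟩ := exists_form_of_isEllipsoid he₁
    have hr' (z : X) : r * p₂ z = p₁ z := by
      have := apply_eq_of_closedBall_eq_image (p := p₂) hp₁
        (LinearEquiv.smulOfNeZero ℝ X r hr.ne') c hrc z
      rw [← this, LinearEquiv.smulOfNeZero_apply, map_smul_eq_mul, Real.norm_of_nonneg hr.le]
    have h2 : IsNormalTo p₂ y x ↔ IsNormalTo p₁ y x := by
      simp only [IsNormalTo, ← hr', mul_le_mul_iff_right₀ hr]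
    rw [h2]
    by_cases hx : x = 0
    · simp [IsNormalTo, hx]
    by_cases hy : y = 0
    · simp [IsNormalTo, hy]
    rw [isNormalTo_iff_form_eq_zero hB hs hx hy, isNormalTo_iff_form_eq_zero hB hs hy hx, hs]
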